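/- Call a set $Z\subset\mathbb C$ locally finite if $Z\cap K$ is finite for every compact $K\subset\mathbb C$, and equip the set of locally finite subsets of $\mathbb C$ with the smallest $\sigma$-algebra making $Z\mapsto |Z\cap A|$ measurable for every compact $A\subset\mathbb C$. A point process in $\mathbb C$ is a random variable with values in this measurable space. The infinite Ginibre point process $\Lambda_\infty$ is the determinantal point process in $\mathbb C$ with kernel $$K_\infty(z,w)=\frac1\pi\exp\left(z\overline w-\tfrac12|z|^2-\tfrac12|w|^2\right),$$ that is, a point process with correlation functions $\psi_k:\mathbb C^k\to[0,\infty)$, $k\ge1$, satisfying $\psi_k(z_1,\dots,z_k)=\det\left[K_\infty(z_i,z_j)\right]_{1\le i,j\le k}$ for Lebesgue-almost all $(z_1,\dots,z_k)\in\mathbb C^k$; being correlation functions means that, for all $k\ge1$ and all pairwise disjoint compact sets $B_1,\dots,B_k\subset\mathbb C$, $$\mathbb E\left(|\Lambda_\infty\cap B_1|\cdots|\Lambda_\infty\cap B_k|\right)=\int_{B_1\times\cdots\times B_k}\psi_k(z_1,\dots,z_k)\,dz_1\cdots dz_k .$$ Theorem. Let $\Lambda_\infty$ be the infinite Ginibre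 point process, and for $r>0$ let $n(r)=|\Lambda_\infty\cap\overline{B(0,r)}|$ be the number of its points in the closed disk of radius $r$ centred at $0$. Then $$\lim_{r\to+\infty}\frac1{r^4}\log\mathbb P\left(n(r)=0\right)=-\frac14 .$$ -/

import Mathlib

open MeasureTheory Filter Topology
open scoped ENNReal NNReal

namespace PointProcess

/-- The locally finite subsets of the complex plane: those with finitely many points in every
compact set. -/
def LocFinSubset : Type :=
  {Z : Set ℂ // ∀ K : Set ℂ, IsCompact K → (Z ∩ K).Finite}

/-- The number `|Z ∩ A|` of points of `Z` in `A`; it is the true cardinality whenever `A` is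
bounded, in particular when `A` is compact, because `Z ∩ A` is then finite. -/
noncomputable def count (Z : LocFinSubset) (A : Set ℂ) : ℕ :=
  (Z.1 ∩ A).ncard

/-- The smallest sigma-algebra for which `Z ↦ |Z ∩ A|` is measurable for all compact `A`. -/
noncomputable instance instMeasurableSpaceLocFinSubset : MeasurableSpace LocFinSubset :=
  ⨆ (A : Set ℂ) (_ : IsCompact A), MeasurableSpace.comap (fun Z => count Z A) ⊤

/-- A point process in the plane: a random variable with values in the locally finite sets. -/
def IsPointProcess {Ω : Type*} [MeasurableSpace Ω] (Z : Ω → LocFinSubset) : Prop :=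
  Measurable Z

/-- `φ k`, `k ≥ 1`, are the correlation functions of the random locally finite set `Z`:
`E (|Z ∩ B₁| ⋯ |Z ∩ Bₖ|) = ∫_{B₁ × ⋯ × Bₖ} φ k` for all pairwise disjoint compact `B₁, …, Bₖ`. -/
def HasCorrelationFunctions {Ω : Type*} [MeasurableSpace Ω] (P : Measure Ω)
    (Z : Ω → LocFinSubset) (φ : (k : ℕ) → (Fin k → ℂ) → ℝ≥0) : Prop :=
  ∀ k : ℕ, 1 ≤ k → Measurable (φ k) ∧
    ∀ B : Fin k → Set ℂ, (∀ i, IsCompact (B i)) → Pairwise (fun i j => Disjoint (B i) (B j)) →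
      ∫⁻ ω, ∏ i, (count (Z ω) (B i) : ℝ≥0∞) ∂P
        = ∫⁻ z in Set.univ.pi B, (φ k z : ℝ≥0∞)

/-- A determinantal point process with kernel `K`: a point process whose correlation functions
exist and are `det (K (zᵢ, zⱼ))` for Lebesgue-almost all `(z₁, …, zₖ)`. -/
def IsDeterminantal {Ω : Type*} [MeasurableSpace Ω] (P : Measure Ω)
    (Z : Ω → LocFinSubset) (K : ℂ → ℂ → ℂ) : Prop :=
  IsPointProcess Z ∧
    ∃ φ : (k : ℕ) → (Fin k → ℂ) → ℝ≥0, HasCorrelationFunctions P Z φ ∧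
      ∀ k : ℕ, 1 ≤ k → ∀ᵐ z : Fin k → ℂ,
        (((φ k z : ℝ≥0) : ℝ) : ℂ) = (Matrix.of fun i j : Fin k => K (z i) (z j)).det

/-- The kernel `(1/π) exp (z w̄ - |z|²/2 - |w|²/2)`. -/
noncomputable def ginibreKernel (z w : ℂ) : ℂ :=
  (1 / (Real.pi : ℂ)) *
    Complex.exp (z * starRingEnd ℂ w - (1 / 2) * ((‖z‖ ^ 2 : ℝ) : ℂ)
      - (1 / 2) * ((‖w‖ ^ 2 : ℝ) : ℂ))

/-- The infinite Ginibre point process. -/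
def IsInfiniteGinibre {Ω : Type*} [MeasurableSpace Ω] (P : Measure Ω)
    (Z : Ω → LocFinSubset) : Prop :=
  IsDeterminantal P Z ginibreKernel

/-- The hole probability: the probability that `Z` has no point in the closed disk of radius `r`
centred at the origin. -/
noncomputable def holeProbability {Ω : Type*} [MeasurableSpace Ω] (P : Measure Ω)
    (Z : Ω → LocFinSubset) (r : ℝ) : ℝ :=
  P.real {ω | count (Z ω) (Metric.closedBall (0 : ℂ) r) = 0}

end PointProcess

namespace PointProcess

/-! Put s = r². The hole probability is the infinite product over l ≥ 0 of q_l = P(Poisson(s) ≤ l).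
The numbers 1 - q_l are the eigenvalues of the kernel on the disk: the functions zˡ exp(-|z|²/2)
stay orthogonal there by rotation invariance.

The product formula comes from moments. Splitting a compact set into ever finer dyadic cells turns
the correlation identities for disjoint sets into factorial moments
(`lintegral_descFactorial_count`). For the disk these are integrals of determinants, hence limits of
k! times the elementary symmetric polynomials of the 1 - q_l (`integral_det_sum_mul`,
`tendsto_sum_powersetCard_setIntegral_det`). The alternating sum of the binomial moments is P(n =
0), and the alternating sum of the elementary symmetric polynomials is the product of the q_l
(`IsInfiniteGinibre.tendsto_prod_poissonCDF`).

For the asymptotics, if l < ⌊s⌋ then q_l equals its last term e⁻ˢ sˡ / l! up to a factor at most s.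
The logarithms of these terms sum to -s² + (s²/2) log s - ((s²/2) log s - 3s²/4) + o(s²) = -s²/4 +
o(s²) (`tendsto_logPoissonProd`). The factors with l between ⌊s⌋ and roughly 2s contribute O(s log
s), and the remaining ones multiply to at least 1/2 (`log_bounds_of_tendsto_prod`). -/

/-! ### Factorial moments from correlation functions -/

theorem measurable_count_of_isCompact {A : Set ℂ} (hA : IsCompact A) :
    Measurable fun Z : LocFinSubset => count Z A := by
  apply Measurable.of_comap_le
  exact le_iSup₂_of_le A hA le_rfl

theorem LocFinSubset.finite_inter (Z : LocFinSubset) {A K : Set ℂ} (hK : IsCompact K)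
    (hA : A ⊆ K) : (Z.1 ∩ A).Finite :=
  (Z.2 K hK).subset (Set.inter_subset_inter_right _ hA)

/-- The compact bound K matters: `Set.ncard` is 0 on infinite sets, so monotonicity needs
finiteness. -/
theorem LocFinSubset.count_mono (Z : LocFinSubset) {A A' K : Set ℂ} (hK : IsCompact K)
    (hA' : A' ⊆ K) (h : A ⊆ A') : count Z A ≤ count Z A' :=
  Set.ncard_le_ncard (Set.inter_subset_inter_right _ h) (Z.finite_inter hK hA')

/-- The number of points in a bounded increasing union is eventually the number of points in
the members of the union. -/
theorem LocFinSubset.tendsto_count_iUnion (Z : LocFinSubset) {A : ℕ → Set ℂ} (hA : Monotone A)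
    {K : Set ℂ} (hK : IsCompact K) (hAK : ⋃ j, A j ⊆ K) :
    Tendsto (fun j => (count Z (A j) : ℝ≥0∞)) atTop (𝓝 (count Z (⋃ j, A j) : ℝ≥0∞)) := by
  have hmono : Monotone fun j => Z.1 ∩ A j := fun i j hij =>
    Set.inter_subset_inter_right _ (hA hij)
  have h : Tendsto (fun j => Measure.count (Z.1 ∩ A j)) atTop
      (𝓝 (Measure.count (⋃ j, Z.1 ∩ A j))) := tendsto_measure_iUnion_atTop hmono
  rw [← Set.inter_iUnion] at h
  have key : ∀ S : Set ℂ, S ⊆ K → Measure.count (Z.1 ∩ S) = (count Z S : ℝ≥0∞) := by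
    intro S hS
    have hf := Z.finite_inter hK hS
    rw [Measure.count_apply hf.measurableSet, ← hf.cast_ncard_eq]
    rfl
  rw [key _ hAK] at h
  refine h.congr fun j => key _ ((Set.subset_iUnion A j).trans hAK)

/-- A set that is an increasing union of countably many compact sets. -/
def IsSigmaCompactMono (C : Set ℂ) : Prop :=
  ∃ A : ℕ → Set ℂ, Monotone A ∧ (∀ j, IsCompact (A j)) ∧ ⋃ j, A j = C

/-- Monotone convergence on both sides carries the defining identity from compact sets to increasing
unions of them; half-open cells are not compact, so this extension is needed. -/
theorem lintegral_prod_count {Ω : Type*} [MeasurableSpace Ω] {P : Measure Ω}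
    {Z : Ω → LocFinSubset} {φ : (k : ℕ) → (Fin k → ℂ) → ℝ≥0} (hZ : Measurable Z)
    (hφ : HasCorrelationFunctions P Z φ) {k : ℕ} (hk : 1 ≤ k) {C : Fin k → Set ℂ} {K : Set ℂ}
    (hK : IsCompact K) (hCK : ∀ i, C i ⊆ K) (hC : ∀ i, IsSigmaCompactMono (C i))
    (hdisj : Pairwise fun i j => Disjoint (C i) (C j)) :
    ∫⁻ ω, ∏ i, (count (Z ω) (C i) : ℝ≥0∞) ∂P = ∫⁻ z in Set.univ.pi C, (φ k z : ℝ≥0∞) := by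
  choose A hmono hcomp hU using hC
  obtain rfl : (fun i => ⋃ j, A i j) = C := funext hU
  have hAK : ∀ i j, A i j ⊆ K := fun i j => (Set.subset_iUnion (A i) j).trans (hCK i)
  have h1 : Tendsto (fun j => ∫⁻ ω, ∏ i, (count (Z ω) (A i j) : ℝ≥0∞) ∂P) atTop
      (𝓝 (∫⁻ ω, ∏ i, (count (Z ω) (⋃ j, A i j) : ℝ≥0∞) ∂P)) := by
    apply lintegral_tendsto_of_tendsto_of_monotone
    · intro j
      refine (Finset.measurable_fun_prod _ fun i _ => ?_).aemeasurable
      exact (measurable_from_top (f := fun n : ℕ => (n : ℝ≥0∞))).comp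
        ((measurable_count_of_isCompact (hcomp i j)).comp hZ)
    · refine ae_of_all _ fun ω j j' hj => ?_
      refine Finset.prod_le_prod' fun i _ => ?_
      exact_mod_cast (Z ω).count_mono hK (hAK i j') (hmono i hj)
    · refine ae_of_all _ fun ω => ?_
      have := fun i => (Z ω).tendsto_count_iUnion (hmono i) hK (hCK i)
      refine ENNReal.tendsto_finsetProd_of_ne_top _ (fun i _ => this i) fun i _ => ?_
      exact ENNReal.natCast_ne_top _
  have hpi : (Set.univ.pi fun i => ⋃ j, A i j) = ⋃ j, Set.univ.pi fun i => A i j := by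
    rw [Set.iUnion_univ_pi_of_monotone hmono]
  have h2 : Tendsto (fun j => ∫⁻ z in Set.univ.pi (fun i => A i j), (φ k z : ℝ≥0∞)) atTop
      (𝓝 (∫⁻ z in Set.univ.pi (fun i => ⋃ j, A i j), (φ k z : ℝ≥0∞))) := by
    have hm : Monotone fun j => Set.univ.pi fun i => A i j := fun j j' hj =>
      Set.pi_mono fun i _ => hmono i hj
    have := tendsto_measure_iUnion_atTop
      (μ := (volume : Measure (Fin k → ℂ)).withDensity fun z => (φ k z : ℝ≥0∞)) hm
    rw [← hpi] at this
    simpa only [Function.comp_def, withDensity_apply'] using this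
  refine tendsto_nhds_unique h1 (h2.congr fun j => ?_)
  refine ((hφ k hk).2 _ (fun i => hcomp i j) fun i i' hi => ?_).symm
  exact (hdisj hi).mono (Set.subset_iUnion (A i) j) (Set.subset_iUnion (A i') j)

/-- The index of the half-open dyadic square of side `2⁻ᵐ` containing `z`. -/
noncomputable def cell (m : ℕ) (z : ℂ) : ℤ × ℤ := (⌊2 ^ m * z.re⌋, ⌊2 ^ m * z.im⌋)

/-- In each coordinate, [a, a + 1) is the increasing union of the intervals [a, a + 1 - 1/(n + 1)].
-/
theorem isSigmaCompactMono_cell (m : ℕ) (c : ℤ × ℤ) {K : Set ℂ} (hK : IsCompact K) :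
    IsSigmaCompactMono (K ∩ cell m ⁻¹' {c}) := by
  have hu : ∀ (x : ℝ) (a : ℤ), ⌊x⌋ = a ↔ ∃ n : ℕ, x ∈ Set.Icc (a : ℝ) (a + 1 - 1 / (n + 1)) := by
    intro x a
    rw [Int.floor_eq_iff]
    constructor
    · rintro ⟨h1, h2⟩
      obtain ⟨n, hn⟩ := exists_nat_one_div_lt (sub_pos.2 h2)
      exact ⟨n, h1, by linarith⟩
    · rintro ⟨n, h1, h2⟩
      have : (0 : ℝ) < 1 / (n + 1) := Nat.one_div_pos_of_nat
      exact ⟨h1, by linarith⟩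
  have hm : ∀ a : ℤ, Monotone fun n : ℕ => Set.Icc (a : ℝ) (a + 1 - 1 / ((n : ℝ) + 1)) := by
    intro a n n' h
    refine Set.Icc_subset_Icc_right ?_
    have := Nat.one_div_le_one_div (α := ℝ) h
    linarith
  let A : ℕ → Set ℂ := fun n => K ∩ ({z | 2 ^ m * z.re ∈ Set.Icc (c.1 : ℝ) (c.1 + 1 - 1 / (n + 1))} ∩
    {z | 2 ^ m * z.im ∈ Set.Icc (c.2 : ℝ) (c.2 + 1 - 1 / (n + 1))})
  refine ⟨A, fun n n' h z hz => ⟨hz.1, hm _ h hz.2.1, hm _ h hz.2.2⟩, fun n => ?_, ?_⟩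
  · refine hK.inter_right (IsClosed.inter ?_ ?_)
    · exact isClosed_Icc.preimage (by fun_prop)
    · exact isClosed_Icc.preimage (by fun_prop)
  · ext z
    simp only [A, Set.mem_iUnion, Set.mem_inter_iff, Set.mem_preimage, Set.mem_singleton_iff, cell,
      Prod.ext_iff, hu, Set.mem_ofPred_eq]
    constructor
    · rintro ⟨n, h0, h1, h2⟩
      exact ⟨h0, ⟨n, h1⟩, ⟨n, h2⟩⟩
    · rintro ⟨h0, ⟨n, h1⟩, ⟨n', h2⟩⟩
      exact ⟨max n n', h0, hm _ (le_max_left _ _) h1, hm _ (le_max_right _ _) h2⟩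

theorem cell_eq_of_cell_succ_eq {m : ℕ} {z w : ℂ} (h : cell (m + 1) z = cell (m + 1) w) :
    cell m z = cell m w := by
  have key : ∀ x : ℝ, ⌊2 ^ m * x⌋ = ⌊2 ^ (m + 1) * x⌋ / 2 := by
    intro x
    have := Int.floor_div_natCast (2 ^ (m + 1) * x) 2
    rw [Nat.cast_ofNat, Nat.cast_ofNat] at this
    rw [← this]
    congr 1
    ring
  simp only [cell, Prod.ext_iff] at h ⊢
  simp only [key]
  rw [h.1, h.2]
  simp

theorem eventually_cell_ne {z w : ℂ} (h : z ≠ w) : ∀ᶠ m in atTop, cell m z ≠ cell m w := by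
  have key : ∀ x y : ℝ, x ≠ y → ∀ᶠ m : ℕ in atTop, ⌊2 ^ m * x⌋ ≠ ⌊2 ^ m * y⌋ := by
    intro x y hxy
    have h1 : Tendsto (fun m : ℕ => (2 : ℝ) ^ m * |x - y|) atTop atTop :=
      (tendsto_pow_atTop_atTop_of_one_lt one_lt_two).atTop_mul_const (abs_pos.2 (sub_ne_zero.2 hxy))
    filter_upwards [h1.eventually_ge_atTop 1] with m hm he
    have := Int.abs_sub_lt_one_of_floor_eq_floor he
    rw [← mul_sub, abs_mul, abs_of_pos (by positivity)] at this
    linarith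
  by_cases hre : z.re = w.re
  · have him : z.im ≠ w.im := fun h' => h (Complex.ext hre h')
    filter_upwards [key _ _ him] with m hm he
    exact hm (congrArg Prod.snd he)
  · filter_upwards [key _ _ hre] with m hm he
    exact hm (congrArg Prod.fst he)

/-- The tuples of points of `S` lying in pairwise distinct dyadic squares of side `2⁻ᵐ`. -/
def separatedTuples (k m : ℕ) (S : Set ℂ) : Set (Fin k → ℂ) :=
  {z | (∀ i, z i ∈ S) ∧ Function.Injective (cell m ∘ z)}

theorem monotone_separatedTuples (k : ℕ) (S : Set ℂ) :
    Monotone fun m => separatedTuples k m S := by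
  refine monotone_nat_of_le_succ fun m z hz => ⟨hz.1, fun i j hij => ?_⟩
  exact hz.2 (cell_eq_of_cell_succ_eq hij)

theorem iUnion_separatedTuples (k : ℕ) (S : Set ℂ) :
    ⋃ m, separatedTuples k m S = {z | (∀ i, z i ∈ S) ∧ Function.Injective z} := by
  ext z
  simp only [Set.mem_iUnion, separatedTuples, Set.mem_ofPred_eq]
  constructor
  · rintro ⟨m, h0, h1⟩
    exact ⟨h0, h1.of_comp⟩
  · rintro ⟨h0, h1⟩
    have : ∀ᶠ m in atTop, ∀ i j, i ≠ j → cell m (z i) ≠ cell m (z j) := by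
      refine eventually_all.2 fun i => eventually_all.2 fun j => ?_
      by_cases hij : i = j
      · simp [hij]
      · filter_upwards [eventually_cell_ne (h1.ne hij)] with m hm _ using hm
    obtain ⟨m, hm⟩ := this.exists
    exact ⟨m, h0, fun i j hij => by_contra fun hne => hm i j hne hij⟩

theorem separatedTuples_eq_iUnion (k m : ℕ) (S : Set ℂ) :
    separatedTuples k m S = ⋃ c : Fin k ↪ ℤ × ℤ, Set.univ.pi fun i => S ∩ cell m ⁻¹' {c i} := by
  ext z
  simp only [separatedTuples, Set.mem_ofPred_eq, Set.mem_iUnion, Set.mem_univ_pi, Set.mem_inter_iff,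
    Set.mem_preimage, Set.mem_singleton_iff]
  constructor
  · rintro ⟨h0, h1⟩
    exact ⟨⟨_, h1⟩, fun i => ⟨h0 i, rfl⟩⟩
  · rintro ⟨c, hc⟩
    refine ⟨fun i => (hc i).1, ?_⟩
    have : cell m ∘ z = c := funext fun i => (hc i).2
    rw [this]
    exact c.injective

theorem pairwise_disjoint_pi_cell (k m : ℕ) (S : Set ℂ) :
    Pairwise (Function.onFun Disjoint fun c : Fin k ↪ ℤ × ℤ =>
      Set.univ.pi fun i => S ∩ cell m ⁻¹' {c i}) := by
  intro c c' hc
  refine Set.disjoint_left.2 fun z hz hz' => hc ?_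
  ext1 i
  exact (hz i trivial).2.symm.trans (hz' i trivial).2

theorem count_pi_eq_prod_ncard {k : ℕ} {F : Fin k → Set ℂ} (hF : ∀ i, (F i).Finite) :
    Measure.count (Set.univ.pi F) = ∏ i, ((F i).ncard : ℝ≥0∞) := by
  lift F to Fin k → Finset ℂ using hF
  rw [← Fintype.coe_piFinset, Measure.count_apply_finset, Fintype.card_piFinset]
  simp

theorem count_injective_tuples {F : Set ℂ} (hF : F.Finite) (k : ℕ) :
    Measure.count {z : Fin k → ℂ | (∀ i, z i ∈ F) ∧ Function.Injective z}
      = (F.ncard.descFactorial k : ℝ≥0∞) := by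
  have := hF.fintype
  let e : {z : Fin k → ℂ | (∀ i, z i ∈ F) ∧ Function.Injective z} ≃ (Fin k ↪ F) :=
    { toFun := fun z => ⟨fun i => ⟨z.1 i, z.2.1 i⟩, fun i j h => z.2.2 (congrArg Subtype.val h)⟩
      invFun := fun f => ⟨fun i => f i, fun i => (f i).2,
        Subtype.val_injective.comp f.injective⟩
      left_inv := fun z => rfl
      right_inv := fun f => rfl }
  have hfin : {z : Fin k → ℂ | (∀ i, z i ∈ F) ∧ Function.Injective z}.Finite :=
    Set.finite_coe_iff.1 (Finite.of_equiv _ e.symm)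
  rw [Measure.count_apply hfin.measurableSet, ← hfin.cast_ncard_eq, ← Nat.card_coe_set_eq,
    Nat.card_congr e, Nat.card_eq_fintype_card, Fintype.card_embedding_eq, Fintype.card_fin,
    ← Nat.card_eq_fintype_card, Nat.card_coe_set_eq]
  rfl

theorem measurable_cell (m : ℕ) : Measurable (cell m) := by
  unfold cell
  fun_prop

/-- The falling factorial counts ordered k-tuples of distinct points. At a fixed mesh, the tuples
with points in distinct cells form a disjoint union of boxes; refining the mesh exhausts all
injective tuples. -/
theorem lintegral_descFactorial_count {Ω : Type*} [MeasurableSpace Ω] {P : Measure Ω}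
    {Z : Ω → LocFinSubset} {φ : (k : ℕ) → (Fin k → ℂ) → ℝ≥0} (hZ : Measurable Z)
    (hφ : HasCorrelationFunctions P Z φ) {k : ℕ} (hk : 1 ≤ k) {K : Set ℂ} (hK : IsCompact K) :
    ∫⁻ ω, ((count (Z ω) K).descFactorial k : ℝ≥0∞) ∂P
      = ∫⁻ z in {z : Fin k → ℂ | (∀ i, z i ∈ K) ∧ Function.Injective z}, (φ k z : ℝ≥0∞) := by
  have hfin : ∀ ω, ((Z ω).1 ∩ K).Finite := fun ω => (Z ω).2 K hK
  have hcellmeas : ∀ m c, MeasurableSet (K ∩ cell m ⁻¹' {c}) := fun m c =>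
    hK.measurableSet.inter (measurable_cell m (measurableSet_singleton c))
  have hcount : Countable (Fin k ↪ ℤ × ℤ) := DFunLike.coe_injective.countable
  -- the number of separated tuples, as a sum over tuples of distinct cells
  have hsum : ∀ m ω, Measure.count (separatedTuples k m ((Z ω).1 ∩ K))
      = ∑' c : Fin k ↪ ℤ × ℤ, ∏ i, (count (Z ω) (K ∩ cell m ⁻¹' {c i}) : ℝ≥0∞) := by
    intro m ω
    have hf : ∀ (c : Fin k ↪ ℤ × ℤ) i, ((Z ω).1 ∩ K ∩ cell m ⁻¹' {c i}).Finite := fun c i =>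
      (hfin ω).subset Set.inter_subset_left
    rw [separatedTuples_eq_iUnion, measure_iUnion (pairwise_disjoint_pi_cell k m _)
      fun c => (Set.Finite.pi (hf c)).measurableSet]
    refine tsum_congr fun c => ?_
    rw [count_pi_eq_prod_ncard (hf c)]
    simp only [count, Set.inter_assoc]
  have hmeas : ∀ m (c : Fin k ↪ ℤ × ℤ) i,
      Measurable fun ω => (count (Z ω) (K ∩ cell m ⁻¹' {c i}) : ℝ≥0∞) := by
    intro m c i
    obtain ⟨A, hA, hA', hU⟩ := isSigmaCompactMono_cell m (c i) hK
    refine measurable_of_tendsto_metrizable (f := fun j ω => (count (Z ω) (A j) : ℝ≥0∞))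
      (fun j => ?_) ?_
    · exact (measurable_from_top (f := fun n : ℕ => (n : ℝ≥0∞))).comp
        ((measurable_count_of_isCompact (hA' j)).comp hZ)
    · refine tendsto_pi_nhds.2 fun ω => ?_
      rw [← hU]
      exact (Z ω).tendsto_count_iUnion hA hK (hU ▸ Set.inter_subset_left)
  have hmeas' : ∀ m (c : Fin k ↪ ℤ × ℤ),
      Measurable fun ω => ∏ i, (count (Z ω) (K ∩ cell m ⁻¹' {c i}) : ℝ≥0∞) := fun m c =>
    Finset.measurable_fun_prod _ fun i _ => hmeas m c i
  -- The index c is an embedding, so the sides of each box are disjoint and the correlation identity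
  -- applies box by box.
  have heq : ∀ m, ∫⁻ ω, Measure.count (separatedTuples k m ((Z ω).1 ∩ K)) ∂P
      = ∫⁻ z in separatedTuples k m K, (φ k z : ℝ≥0∞) := by
    intro m
    simp_rw [hsum]
    rw [lintegral_tsum fun c => (hmeas' m c).aemeasurable, separatedTuples_eq_iUnion,
      lintegral_iUnion (s := fun c : Fin k ↪ ℤ × ℤ => Set.univ.pi fun i => K ∩ cell m ⁻¹' {c i})
        (fun c => MeasurableSet.univ_pi fun i => hcellmeas m (c i))
        (pairwise_disjoint_pi_cell k m _)]
    refine tsum_congr fun c => ?_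
    refine lintegral_prod_count hZ hφ hk hK (fun i => Set.inter_subset_left)
      (fun i => isSigmaCompactMono_cell m _ hK) fun i j hij => ?_
    refine Set.disjoint_left.2 fun z hz hz' => hij (c.injective ?_)
    exact hz.2.symm.trans hz'.2
  have h1 : Tendsto (fun m => ∫⁻ ω, Measure.count (separatedTuples k m ((Z ω).1 ∩ K)) ∂P) atTop
      (𝓝 (∫⁻ ω, ((count (Z ω) K).descFactorial k : ℝ≥0∞) ∂P)) := by
    apply lintegral_tendsto_of_tendsto_of_monotone
    · intro m
      simp_rw [hsum]
      exact (Measurable.tsum fun c => hmeas' m c).aemeasurable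
    · exact ae_of_all _ fun ω m m' h => measure_mono (monotone_separatedTuples k _ h)
    · refine ae_of_all _ fun ω => ?_
      have := tendsto_measure_iUnion_atTop (μ := Measure.count)
        (monotone_separatedTuples k ((Z ω).1 ∩ K))
      rwa [iUnion_separatedTuples, count_injective_tuples (hfin ω)] at this
  have h2 : Tendsto (fun m => ∫⁻ z in separatedTuples k m K, (φ k z : ℝ≥0∞)) atTop
      (𝓝 (∫⁻ z in {z : Fin k → ℂ | (∀ i, z i ∈ K) ∧ Function.Injective z}, (φ k z : ℝ≥0∞))) := by
    have := tendsto_measure_iUnion_atTop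
      (μ := (volume : Measure (Fin k → ℂ)).withDensity fun z => (φ k z : ℝ≥0∞))
      (monotone_separatedTuples k K)
    rw [iUnion_separatedTuples] at this
    simpa only [Function.comp_def, withDensity_apply'] using this
  exact tendsto_nhds_unique h1 (h2.congr fun m => (heq m).symm)

/-- The factorial moments of the number of points in a compact set, for a process whose correlation
functions vanish almost everywhere on the diagonals. -/
theorem lintegral_descFactorial_count_eq_setLIntegral_pi {Ω : Type*} [MeasurableSpace Ω]
    {P : Measure Ω} {Z : Ω → LocFinSubset} {φ : (k : ℕ) → (Fin k → ℂ) → ℝ≥0} (hZ : Measurable Z)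
    (hφ : HasCorrelationFunctions P Z φ) {k : ℕ} (hk : 1 ≤ k) {K : Set ℂ} (hK : IsCompact K)
    (hdiag : ∀ᵐ z : Fin k → ℂ, ¬ Function.Injective z → φ k z = 0) :
    ∫⁻ ω, ((count (Z ω) K).descFactorial k : ℝ≥0∞) ∂P
      = ∫⁻ z in Set.univ.pi fun _ : Fin k => K, (φ k z : ℝ≥0∞) := by
  rw [lintegral_descFactorial_count hZ hφ hk hK]
  have hK' : MeasurableSet (Set.univ.pi fun _ : Fin k => K) :=
    MeasurableSet.univ_pi fun _ => hK.measurableSet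
  have hinj : MeasurableSet {z : Fin k → ℂ | Function.Injective z} := by
    simp only [Function.Injective, Set.ofPred_forall]
    refine MeasurableSet.iInter fun i => MeasurableSet.iInter fun j => ?_
    by_cases hij : i = j
    · simp [hij]
    · simp only [hij, imp_false]
      exact (measurableSet_eq_fun (measurable_pi_apply i) (measurable_pi_apply j)).compl
  have hset : {z : Fin k → ℂ | (∀ i, z i ∈ K) ∧ Function.Injective z}
      = (Set.univ.pi fun _ : Fin k => K) ∩ {z | Function.Injective z} := by
    ext z
    simp
  rw [hset, ← lintegral_indicator (hK'.inter hinj), ← lintegral_indicator hK']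
  refine lintegral_congr_ae ?_
  filter_upwards [hdiag] with z hz
  by_cases h : Function.Injective z
  · by_cases hzK : z ∈ Set.univ.pi fun _ => K
    · rw [Set.indicator_of_mem hzK, Set.indicator_of_mem (Set.mem_inter hzK h)]
    · rw [Set.indicator_of_notMem hzK, Set.indicator_of_notMem fun h' => hzK h'.1]
  · simp [Set.indicator, h, hz h]

/-! ### Integrals of determinants of finite rank kernels -/

/-- Each k-element set s is the image of exactly k! injections, namely the bijections from `Fin k`
to s. -/
theorem sum_injective_prod_eq {R ι : Type*} [CommSemiring R] [Fintype ι] [DecidableEq ι] (k : ℕ)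
    (x : ι → R) :
    ∑ l : Fin k → ι with Function.Injective l, ∏ i, x (l i)
      = (k.factorial : R) * ∑ s ∈ Finset.univ.powersetCard k, ∏ i ∈ s, x i := by
  have hmaps : ∀ l ∈ (Finset.univ.filter fun l : Fin k → ι => Function.Injective l),
      Finset.univ.image l ∈ (Finset.univ : Finset ι).powersetCard k := by
    intro l hl
    rw [Finset.mem_powersetCard_univ, Finset.card_image_of_injective _ (Finset.mem_filter.1 hl).2]
    simp
  rw [← Finset.sum_fiberwise_of_maps_to hmaps, Finset.mul_sum]
  refine Finset.sum_congr rfl fun s hs => ?_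
  have hprod : ∀ l ∈ (Finset.univ.filter fun l : Fin k → ι => Function.Injective l).filter
      (fun l => Finset.univ.image l = s), ∏ i, x (l i) = ∏ i ∈ s, x i := by
    intro l hl
    simp only [Finset.mem_filter, Finset.mem_univ, true_and] at hl
    rw [← hl.2, Finset.prod_image fun a _ b _ h => hl.1 h]
  rw [Finset.sum_congr rfl hprod, Finset.sum_const, nsmul_eq_mul]
  congr 2
  have hcard : Fintype.card s = k := by simpa using hs
  let e : (Fin k ≃ s) ≃ {l : Fin k → ι // l ∈ (Finset.univ.filter
      fun l : Fin k → ι => Function.Injective l).filter (fun l => Finset.univ.image l = s)} :=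
    { toFun := fun f => ⟨fun i => f i, by
        simp only [Finset.mem_filter, Finset.mem_univ, true_and]
        refine ⟨Subtype.val_injective.comp f.injective, ?_⟩
        ext a
        simp only [Finset.mem_image, Finset.mem_univ, true_and]
        exact ⟨fun ⟨i, hi⟩ => hi ▸ (f i).2, fun ha => ⟨f.symm ⟨a, ha⟩, by simp⟩⟩⟩
      invFun := fun l => Equiv.ofBijective
        (fun i => (⟨l.1 i, by
          have := l.2
          simp only [Finset.mem_filter, Finset.mem_univ, true_and] at this
          exact this.2.subset (Finset.mem_image_of_mem _ (Finset.mem_univ i))⟩ : s)) (by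
        have := l.2
        simp only [Finset.mem_filter, Finset.mem_univ, true_and] at this
        refine ⟨fun i j h => this.1 (congrArg Subtype.val h), fun a => ?_⟩
        obtain ⟨i, -, hi⟩ := Finset.mem_image.1 (this.2.symm.subset a.2)
        exact ⟨i, Subtype.ext hi⟩)
      left_inv := fun f => by ext; rfl
      right_inv := fun l => rfl }
  rw [← Fintype.card_coe, ← Fintype.card_congr e,
    Fintype.card_equiv (Fintype.equivOfCardEq (by simp [hcard])), Fintype.card_fin]

theorem det_kronecker_comp {R ι : Type*} [CommRing R] [DecidableEq ι] {k : ℕ} (l : Fin k → ι)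
    [Decidable (Function.Injective l)] :
    (Matrix.of fun i j : Fin k => if l i = l j then (1 : R) else 0).det
      = if Function.Injective l then 1 else 0 := by
  split_ifs with h
  · have : (Matrix.of fun i j : Fin k => if l i = l j then (1 : R) else 0) = 1 := by
      ext i j
      simp [Matrix.one_apply, h.eq_iff]
    rw [this, Matrix.det_one]
  · simp only [Function.Injective, not_forall] at h
    obtain ⟨i, j, hij, hne⟩ := h
    refine Matrix.det_zero_of_row_eq hne ?_
    ext a
    simp [hij]

/-- The integral of the determinant of a finite rank kernel `∑ fₗ(z) gₗ(w)` given by a biorthogonal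
family. -/
theorem integral_det_sum_mul {E ι : Type*} [MeasurableSpace E] (μ : Measure E) [SigmaFinite μ]
    [Fintype ι] [DecidableEq ι] (f g : ι → E → ℂ) (γ : ι → ℂ)
    (hint : ∀ a b, Integrable (fun z => f a z * g b z) μ)
    (horth : ∀ a b, ∫ z, f a z * g b z ∂μ = if a = b then γ b else 0) (k : ℕ) :
    ∫ z, (Matrix.of fun i j : Fin k => ∑ l, f l (z i) * g l (z j)).det ∂Measure.pi (fun _ => μ)
      = ∑ l : Fin k → ι with Function.Injective l, ∏ i, γ (l i) := by
  -- Leibniz expansion followed by reindexing along σ gathers all factors in the same variable z i,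
  -- so that each term factorises under the product measure.
  have hexp : ∀ z : Fin k → E, (Matrix.of fun i j : Fin k => ∑ l, f l (z i) * g l (z j)).det
      = ∑ σ : Equiv.Perm (Fin k), ∑ l : Fin k → ι, ((Equiv.Perm.sign σ : ℤ) : ℂ) *
          ∏ i, f (l (σ⁻¹ i)) (z i) * g (l i) (z i) := by
    intro z
    rw [Matrix.det_apply']
    refine Finset.sum_congr rfl fun σ _ => ?_
    simp only [Matrix.of_apply]
    rw [Finset.prod_univ_sum, Fintype.piFinset_univ, Finset.mul_sum]
    refine Finset.sum_congr rfl fun l _ => ?_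
    rw [Finset.prod_mul_distrib, Finset.prod_mul_distrib]
    congr 2
    rw [← Equiv.prod_comp σ fun i => f (l (σ⁻¹ i)) (z i)]
    simp
  simp_rw [hexp]
  have hint' : ∀ (σ : Equiv.Perm (Fin k)) (l : Fin k → ι), Integrable (fun z : Fin k → E =>
      ((Equiv.Perm.sign σ : ℤ) : ℂ) * ∏ i, f (l (σ⁻¹ i)) (z i) * g (l i) (z i))
      (Measure.pi fun _ => μ) := fun σ l =>
    (Integrable.fintype_prod (f := fun i z => f (l (σ⁻¹ i)) z * g (l i) z)
      fun i => hint _ _).const_mul _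
  rw [integral_finsetSum _ fun σ _ => integrable_finsetSum _ fun l _ => hint' σ l]
  simp_rw [integral_finsetSum _ fun l _ => hint' _ l, integral_const_mul]
  rw [Finset.sum_comm, Finset.sum_filter]
  refine Finset.sum_congr rfl fun l _ => ?_
  have h1 : ∀ σ : Equiv.Perm (Fin k),
      ∫ z : Fin k → E, ∏ i, f (l (σ⁻¹ i)) (z i) * g (l i) (z i) ∂(Measure.pi fun _ => μ)
      = (∏ i, γ (l i)) * ∏ i, (if l (σ i) = l i then (1 : ℂ) else 0) := by
    intro σ
    rw [integral_fintype_prod_eq_prod (fun i z => f (l (σ⁻¹ i)) z * g (l i) z)]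
    simp_rw [horth]
    rw [← Equiv.prod_comp σ fun i => (if l (σ⁻¹ i) = l i then γ (l i) else 0),
      ← Equiv.prod_comp σ fun i => γ (l i), ← Finset.prod_mul_distrib]
    refine Finset.prod_congr rfl fun i _ => ?_
    simp [eq_comm]
  simp_rw [h1]
  -- For fixed l, the signed sum over σ is again a determinant, of a 0-1 matrix with two equal rows
  -- unless l is injective.
  have h2 := det_kronecker_comp (R := ℂ) l
  rw [Matrix.det_apply'] at h2
  simp only [Matrix.of_apply] at h2
  calc _ = (∏ i, γ (l i)) * ∑ σ : Equiv.Perm (Fin k), ((Equiv.Perm.sign σ : ℤ) : ℂ) *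
          ∏ i, (if l (σ i) = l i then (1 : ℂ) else 0) := by
        rw [Finset.mul_sum]
        exact Finset.sum_congr rfl fun σ _ => by ring
    _ = _ := by
        rw [h2]
        split_ifs <;> simp

/-! ### Eigenvalues of the Ginibre kernel on a disk -/

/-- The probability that a Poisson variable of mean `s` is at most `l`. -/
noncomputable def poissonCDF (l : ℕ) (s : ℝ) : ℝ :=
  Real.exp (-s) * ∑ j ∈ Finset.range (l + 1), s ^ j / (j.factorial : ℝ)

theorem poissonCDF_succ (l : ℕ) (s : ℝ) : poissonCDF (l + 1) s
    = poissonCDF l s + Real.exp (-s) * (s ^ (l + 1) / ((l + 1).factorial : ℝ)) := by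
  simp only [poissonCDF, Finset.sum_range_succ _ (l + 1), mul_add]

theorem hasDerivAt_poissonCDF (l : ℕ) (s : ℝ) :
    HasDerivAt (poissonCDF l) (-(Real.exp (-s) * (s ^ l / (l.factorial : ℝ)))) s := by
  have hexp : HasDerivAt (fun s : ℝ => Real.exp (-s)) (-Real.exp (-s)) s := by
    simpa using (hasDerivAt_neg s).exp
  induction l with
  | zero =>
    have heq : poissonCDF 0 = fun s => Real.exp (-s) := funext fun s => by simp [poissonCDF]
    rw [heq]
    simpa using hexp
  | succ l ih =>
    have h := ih.add (hexp.mul ((hasDerivAt_pow (l + 1) s).div_const ((l + 1).factorial : ℝ)))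
    have heq : poissonCDF (l + 1) = fun s => poissonCDF l s
        + Real.exp (-s) * (s ^ (l + 1) / ((l + 1).factorial : ℝ)) := funext (poissonCDF_succ l)
    rw [heq]
    refine h.congr_deriv ?_
    rw [Nat.factorial_succ]
    push_cast
    field_simp
    simp

theorem poissonCDF_zero_right (l : ℕ) : poissonCDF l 0 = 1 := by
  simp [poissonCDF, Finset.sum_range_succ']

/-- In polar coordinates the radial integrand has antiderivative -(l!/2) `poissonCDF l (y ^ 2)`,
because the derivative of the Poisson distribution function in its mean telescopes. -/
theorem setIntegral_closedBall_norm_pow_mul_exp (l : ℕ) {r : ℝ} (hr : 0 ≤ r) :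
    ∫ z in Metric.closedBall (0 : ℂ) r, ‖z‖ ^ (2 * l) * Real.exp (-‖z‖ ^ 2)
      = Real.pi * l.factorial * (1 - poissonCDF l (r ^ 2)) := by
  let h : ℝ → ℝ := fun y => y ^ (2 * l) * Real.exp (-y ^ 2)
  have h1 : ∫ z in Metric.closedBall (0 : ℂ) r, ‖z‖ ^ (2 * l) * Real.exp (-‖z‖ ^ 2)
      = ∫ z : ℂ, (Set.Iic r).indicator h ‖z‖ := by
    rw [← integral_indicator Metric.isClosed_closedBall.measurableSet]
    refine integral_congr_ae (ae_of_all _ fun z => ?_)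
    simp [Set.indicator, h]
  have h2 : ∫ y in Set.Ioi (0 : ℝ), y ^ (2 - 1) • (Set.Iic r).indicator h y
      = ∫ y in (0 : ℝ)..r, y * h y := by
    rw [intervalIntegral.integral_of_le hr, ← Set.Ioi_inter_Iic,
      ← setIntegral_indicator measurableSet_Iic]
    refine integral_congr_ae (ae_of_all _ fun y => ?_)
    simp only [Set.indicator]
    split_ifs <;> simp
  have h3 : ∫ y in (0 : ℝ)..r, y * h y
      = -(l.factorial / 2 : ℝ) * poissonCDF l (r ^ 2)
        - -(l.factorial / 2 : ℝ) * poissonCDF l (0 ^ 2) := by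
    refine intervalIntegral.integral_eq_sub_of_hasDerivAt
      (f := fun y => -(l.factorial / 2 : ℝ) * poissonCDF l (y ^ 2)) (fun y _ => ?_) ?_
    · have := ((hasDerivAt_poissonCDF l (y ^ 2)).comp y (hasDerivAt_pow 2 y)).const_mul
        (-(l.factorial / 2 : ℝ))
      refine this.congr_deriv ?_
      simp only [h]
      have : (l.factorial : ℝ) ≠ 0 := by positivity
      field_simp
      ring
    · exact Continuous.intervalIntegrable (by fun_prop) _ _
  rw [h1, integral_fun_norm_addHaar, Complex.finrank_real_complex, h2, h3]
  have hvol : (volume : Measure ℂ).real (Metric.ball 0 1) = Real.pi := by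
    simp [Measure.real, Complex.volume_ball]
  rw [hvol, zero_pow two_ne_zero, poissonCDF_zero_right]
  simp only [nsmul_eq_mul, smul_eq_mul]
  push_cast
  ring

/-- The functions `zˡ exp (-|z|² / 2)`. -/
noncomputable def ginibreMode (l : ℕ) (z : ℂ) : ℂ := z ^ l * (Real.exp (-‖z‖ ^ 2 / 2) : ℝ)

/-- The conjugates of the functions `zˡ exp (-|z|² / 2)`, normalised in `L²`. -/
noncomputable def ginibreDualMode (l : ℕ) (z : ℂ) : ℂ :=
  starRingEnd ℂ (ginibreMode l z) / (Real.pi * l.factorial)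

@[fun_prop]
theorem continuous_ginibreMode (l : ℕ) : Continuous (ginibreMode l) := by
  unfold ginibreMode
  fun_prop

@[fun_prop]
theorem continuous_ginibreDualMode (l : ℕ) : Continuous (ginibreDualMode l) := by
  unfold ginibreDualMode
  exact (Complex.continuous_conj.comp (continuous_ginibreMode l)).div_const _

theorem setIntegral_closedBall_ginibreMode_mul (a b : ℕ) {r : ℝ} (hr : 0 ≤ r) :
    ∫ z in Metric.closedBall (0 : ℂ) r, ginibreMode a z * ginibreDualMode b z
      = if a = b then ((1 - poissonCDF b (r ^ 2) : ℝ) : ℂ) else 0 := by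
  split_ifs with hab
  · subst hab
    have : ∀ z : ℂ, ginibreMode a z * ginibreDualMode a z
        = ((‖z‖ ^ (2 * a) * Real.exp (-‖z‖ ^ 2) / (Real.pi * a.factorial) : ℝ) : ℂ) := by
      intro z
      rw [ginibreDualMode, ← mul_div_assoc, Complex.mul_conj, Complex.normSq_eq_norm_sq,
        ginibreMode, norm_mul, norm_pow, Complex.norm_real, Real.norm_of_nonneg (Real.exp_pos _).le,
        mul_pow, ← pow_mul, mul_comm a 2, ← Real.exp_nat_mul]
      push_cast
      congr 4
      ring
    simp_rw [this]
    rw [integral_complex_ofReal, integral_div, setIntegral_closedBall_norm_pow_mul_exp a hr]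
    congr 1
    field_simp
  · have hne : ((a : ℝ) - b) ≠ 0 := sub_ne_zero.2 (by exact_mod_cast hab)
    -- Rotation by this angle multiplies the integrand by exp(iπ) = -1 and preserves the disk, so
    -- the integral equals its own negative.
    let c : Circle := Circle.exp (Real.pi / (a - b))
    have hc : (c : ℂ) ^ a * (starRingEnd ℂ (c : ℂ)) ^ b = -1 := by
      rw [← Circle.coe_inv_eq_conj, ← Circle.exp_neg, Circle.coe_exp, Circle.coe_exp,
        ← Complex.exp_nat_mul, ← Complex.exp_nat_mul, ← Complex.exp_add, ← Complex.exp_pi_mul_I]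
      congr 1
      have : (a : ℂ) - b ≠ 0 := by exact_mod_cast hne
      push_cast
      field_simp
      ring
    have hrot : ∀ z, ginibreMode a (rotation c z) * ginibreDualMode b (rotation c z)
        = -(ginibreMode a z * ginibreDualMode b z) := by
      intro z
      simp only [ginibreDualMode, ginibreMode, LinearIsometryEquiv.norm_map]
      simp only [rotation_apply, mul_pow, map_mul, map_pow]
      linear_combination (z ^ a * (Real.exp (-‖z‖ ^ 2 / 2) : ℝ) * ((starRingEnd ℂ z) ^ b *
        starRingEnd ℂ (Real.exp (-‖z‖ ^ 2 / 2) : ℝ) / (Real.pi * b.factorial)) : ℂ) * hc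
    have hpre : rotation c ⁻¹' Metric.closedBall (0 : ℂ) r = Metric.closedBall (0 : ℂ) r := by
      ext z
      rw [Set.mem_preimage, mem_closedBall_zero_iff, mem_closedBall_zero_iff,
        LinearIsometryEquiv.norm_map]
    have h := (rotation c).measurePreserving.setIntegral_preimage_emb
      (rotation c).toHomeomorph.measurableEmbedding
      (fun z => ginibreMode a z * ginibreDualMode b z) (Metric.closedBall (0 : ℂ) r)
    rw [hpre] at h
    simp_rw [hrot] at h
    rw [integral_neg] at h
    linear_combination -(1 / 2 : ℂ) * h

theorem hasSum_ginibreKernel (z w : ℂ) :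
    HasSum (fun l => ginibreMode l z * ginibreDualMode l w) (ginibreKernel z w) := by
  have h := (NormedSpace.expSeries_div_hasSum_exp (z * starRingEnd ℂ w)).mul_left
    ((1 / Real.pi : ℂ) * Real.exp (-‖z‖ ^ 2 / 2) * Real.exp (-‖w‖ ^ 2 / 2))
  have hval : (1 / Real.pi : ℂ) * Real.exp (-‖z‖ ^ 2 / 2) * Real.exp (-‖w‖ ^ 2 / 2)
      * NormedSpace.exp (z * starRingEnd ℂ w) = ginibreKernel z w := by
    rw [← Complex.exp_eq_exp_ℂ, ginibreKernel, Complex.ofReal_exp, Complex.ofReal_exp, mul_assoc,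
      mul_assoc, ← Complex.exp_add, ← Complex.exp_add]
    congr 2
    push_cast
    ring
  rw [hval] at h
  refine (funext fun l => ?_ : (fun l => ginibreMode l z * ginibreDualMode l w) = _) ▸ h
  rw [ginibreDualMode, ginibreMode, ginibreMode, map_mul, Complex.conj_ofReal, map_pow, mul_pow]
  field_simp

/-- A bound independent of N, used to dominate the determinants of the truncated kernels. -/
theorem norm_sum_ginibreMode_mul_le (N : ℕ) {z w : ℂ} {r : ℝ} (hz : ‖z‖ ≤ r) (hw : ‖w‖ ≤ r) :
    ‖∑ l : Fin N, ginibreMode l z * ginibreDualMode l w‖ ≤ Real.exp (r ^ 2) := by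
  have hr : 0 ≤ r := (norm_nonneg z).trans hz
  have hexp : ∀ z : ℂ, ‖((Real.exp (-‖z‖ ^ 2 / 2) : ℝ) : ℂ)‖ ≤ 1 := by
    intro z
    rw [Complex.norm_real, Real.norm_of_nonneg (Real.exp_pos _).le, Real.exp_le_one_iff]
    have := sq_nonneg ‖z‖
    linarith
  have hmode : ∀ (l : ℕ) {z : ℂ}, ‖z‖ ≤ r → ‖ginibreMode l z‖ ≤ r ^ l := by
    intro l z hz
    rw [ginibreMode, norm_mul, norm_pow]
    calc _ ≤ r ^ l * 1 := by gcongr; exact hexp z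
      _ = _ := mul_one _
  have hdual : ∀ l : ℕ, ‖ginibreDualMode l w‖ ≤ r ^ l / l.factorial := by
    intro l
    rw [ginibreDualMode, norm_div, RCLike.norm_conj]
    have h1 : (l.factorial : ℝ) ≤ ‖(Real.pi * l.factorial : ℂ)‖ := by
      rw [norm_mul, Complex.norm_real, Real.norm_of_nonneg Real.pi_pos.le, Complex.norm_natCast]
      have : (1 : ℝ) ≤ Real.pi := by linarith [Real.pi_gt_three]
      nlinarith [(Nat.cast_nonneg l.factorial : (0 : ℝ) ≤ l.factorial)]
    have h2 : (0 : ℝ) < l.factorial := by positivity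
    exact div_le_div₀ (by positivity) (hmode l hw) h2 h1
  calc _ ≤ ∑ l : Fin N, ‖ginibreMode l z * ginibreDualMode l w‖ := norm_sum_le _ _
    _ ≤ ∑ l : Fin N, (r ^ 2) ^ (l : ℕ) / (l : ℕ).factorial := by
        refine Finset.sum_le_sum fun l _ => ?_
        rw [norm_mul]
        calc _ ≤ r ^ (l : ℕ) * (r ^ (l : ℕ) / (l : ℕ).factorial) := by
              gcongr
              · exact hmode l hz
              · exact hdual l
          _ = _ := by ring
    _ = ∑ l ∈ Finset.range N, (r ^ 2) ^ l / l.factorial :=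
        Fin.sum_univ_eq_sum_range (fun l => (r ^ 2) ^ l / (l.factorial : ℝ)) N
    _ ≤ _ := Real.sum_le_exp_of_nonneg (sq_nonneg r) N

theorem norm_det_le {k : ℕ} {A : Matrix (Fin k) (Fin k) ℂ} {x : ℝ} (hA : ∀ i j, ‖A i j‖ ≤ x) :
    ‖A.det‖ ≤ k.factorial * x ^ k := by
  have := Matrix.det_le (A := A) (abv := NormedField.toAbsoluteValue ℂ) hA
  rw [nsmul_eq_mul, Fintype.card_fin] at this
  exact this

/-- The truncated kernels have rank at most N and explicit determinant integrals; dominated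
convergence passes to the full kernel. -/
theorem tendsto_sum_powersetCard_setIntegral_det (k : ℕ) {r : ℝ} (hr : 0 ≤ r) :
    Tendsto (fun N : ℕ => (((k.factorial : ℝ) * ∑ s ∈ (Finset.univ : Finset (Fin N)).powersetCard k,
        ∏ l ∈ s, (1 - poissonCDF l (r ^ 2)) : ℝ) : ℂ)) atTop
      (𝓝 (∫ z in Set.univ.pi fun _ : Fin k => Metric.closedBall (0 : ℂ) r,
        (Matrix.of fun i j : Fin k => ginibreKernel (z i) (z j)).det)) := by
  have hmeasB : MeasurableSet (Set.univ.pi fun _ : Fin k => Metric.closedBall (0 : ℂ) r) :=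
    MeasurableSet.univ_pi fun _ => Metric.isClosed_closedBall.measurableSet
  have hfin : ∀ N : ℕ, ∫ z in Set.univ.pi fun _ : Fin k => Metric.closedBall (0 : ℂ) r,
      (Matrix.of fun i j : Fin k =>
        ∑ l : Fin N, ginibreMode l (z i) * ginibreDualMode l (z j)).det
      = (((k.factorial : ℝ) * ∑ s ∈ (Finset.univ : Finset (Fin N)).powersetCard k,
        ∏ l ∈ s, (1 - poissonCDF l (r ^ 2)) : ℝ) : ℂ) := by
    intro N
    rw [volume_pi, Measure.restrict_pi_pi]
    rw [integral_det_sum_mul (volume.restrict (Metric.closedBall (0 : ℂ) r))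
      (fun l : Fin N => ginibreMode l) (fun l : Fin N => ginibreDualMode l)
      (fun l => ((1 - poissonCDF l (r ^ 2) : ℝ) : ℂ)),
      sum_injective_prod_eq k fun l : Fin N => ((1 - poissonCDF l (r ^ 2) : ℝ) : ℂ)]
    · push_cast
      rfl
    · intro a b
      exact ContinuousOn.integrableOn_compact (isCompact_closedBall _ _)
        (Continuous.continuousOn (by fun_prop))
    · intro a b
      rw [setIntegral_closedBall_ginibreMode_mul _ _ hr]
      simp [Fin.ext_iff]
  simp_rw [← hfin]
  refine tendsto_integral_of_dominated_convergence
    (fun _ => (k.factorial : ℝ) * Real.exp (r ^ 2) ^ k) (fun N => ?_) ?_ (fun N => ?_) ?_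
  · refine Continuous.aestronglyMeasurable ?_
    exact Continuous.matrix_det (continuous_matrix fun i j => by
      simp only [Matrix.of_apply]
      fun_prop)
  · have : IsFiniteMeasure ((volume : Measure (Fin k → ℂ)).restrict
        (Set.univ.pi fun _ : Fin k => Metric.closedBall (0 : ℂ) r)) :=
      ⟨by
        rw [Measure.restrict_apply_univ]
        exact (isCompact_univ_pi fun _ => isCompact_closedBall _ _).measure_lt_top⟩
    exact integrable_const _
  · refine (ae_restrict_iff' hmeasB).2 (ae_of_all _ fun z hz => ?_)
    refine norm_det_le fun i j => ?_
    exact norm_sum_ginibreMode_mul_le N (by simpa using hz i trivial) (by simpa using hz j trivial)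
  · refine ae_of_all _ fun z => ?_
    refine (Continuous.tendsto (f := Matrix.det) (by fun_prop) _).comp ?_
    refine tendsto_pi_nhds.2 fun i => tendsto_pi_nhds.2 fun j => ?_
    simp only [Matrix.of_apply]
    have := (hasSum_ginibreKernel (z i) (z j)).tendsto_sum_nat
    refine this.congr fun N => ?_
    exact (Fin.sum_univ_eq_sum_range (fun l => ginibreMode l (z i) * ginibreDualMode l (z j)) N).symm

/-! ### Tail bounds and elementary symmetric polynomials -/

theorem poissonCDF_le_one (l : ℕ) {s : ℝ} (hs : 0 ≤ s) : poissonCDF l s ≤ 1 := by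
  rw [poissonCDF, Real.exp_neg, inv_mul_le_iff₀ (Real.exp_pos s), mul_one]
  exact Real.sum_le_exp_of_nonneg hs _

/-- For j ≥ n one has sʲ ≤ 2⁻ⁿ (2s)ʲ, so the tail is at most 2⁻ⁿ times the tail of the series at 2s.
-/
theorem exp_sub_sum_le (n : ℕ) {s : ℝ} (hs : 0 ≤ s) :
    Real.exp s - ∑ j ∈ Finset.range n, s ^ j / (j.factorial : ℝ)
      ≤ (1 / 2) ^ n * Real.exp (2 * s) := by
  have h : ∀ x : ℝ, HasSum (fun j : ℕ => x ^ j / (j.factorial : ℝ)) (Real.exp x) := by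
    intro x
    rw [Real.exp_eq_exp_ℝ]
    exact NormedSpace.expSeries_div_hasSum_exp x
  have h1 := (hasSum_nat_add_iff' n).2 (h s)
  have h2 := ((hasSum_nat_add_iff' n).2 (h (2 * s))).mul_left ((1 / 2 : ℝ) ^ n)
  refine (hasSum_le (fun j => ?_) h1 h2).trans ?_
  · rw [mul_pow, ← mul_div_assoc, ← mul_assoc]
    gcongr
    refine le_mul_of_one_le_left (by positivity) ?_
    rw [pow_add, mul_left_comm, ← mul_pow]
    norm_num
    exact one_le_pow₀ one_le_two
  · gcongr
    rw [sub_le_self_iff]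
    exact Finset.sum_nonneg fun j _ => by positivity

theorem one_sub_poissonCDF_le (l : ℕ) {s : ℝ} (hs : 0 ≤ s) :
    1 - poissonCDF l s ≤ (1 / 2) ^ (l + 1) * Real.exp s := by
  have h := mul_le_mul_of_nonneg_left (exp_sub_sum_le (l + 1) hs) (Real.exp_pos (-s)).le
  rw [mul_sub, ← Real.exp_add, neg_add_cancel, Real.exp_zero] at h
  refine h.trans_eq ?_
  rw [mul_left_comm, ← Real.exp_add]
  ring_nf

theorem sum_one_sub_poissonCDF_le (N : ℕ) {s : ℝ} (hs : 0 ≤ s) :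
    ∑ l ∈ Finset.range N, (1 - poissonCDF l s) ≤ Real.exp s := by
  calc _ ≤ ∑ l ∈ Finset.range N, (1 / 2 : ℝ) ^ (l + 1) * Real.exp s :=
        Finset.sum_le_sum fun l _ => one_sub_poissonCDF_le l hs
    _ = (∑ l ∈ Finset.range N, (1 / 2 : ℝ) ^ l) * (1 / 2) * Real.exp s := by
        simp only [pow_succ, Finset.sum_mul]
    _ ≤ 2 * (1 / 2) * Real.exp s := by
        gcongr
        exact sum_geometric_two_le N
    _ = _ := by ring

/-- The left side is the sum over injective index tuples; expanding the power gives the sum over all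
tuples. -/
theorem factorial_mul_sum_powersetCard_le {N : ℕ} (k : ℕ) {x : Fin N → ℝ} (hx : ∀ l, 0 ≤ x l) :
    (k.factorial : ℝ) * ∑ s ∈ (Finset.univ : Finset (Fin N)).powersetCard k, ∏ l ∈ s, x l
      ≤ (∑ l, x l) ^ k := by
  rw [← sum_injective_prod_eq]
  calc _ ≤ ∑ l : Fin k → Fin N, ∏ i, x (l i) :=
        Finset.sum_le_sum_of_subset_of_nonneg (Finset.filter_subset _ _)
          fun l _ _ => Finset.prod_nonneg fun i _ => hx _
    _ = _ := by
        rw [← Fintype.piFinset_univ, ← Finset.prod_univ_sum]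
        simp

/-- The sum is finite, but the `tsum` form removes N from its range, ready for dominated convergence
as N grows. -/
theorem prod_one_sub_eq_tsum {N : ℕ} (x : Fin N → ℝ) :
    ∏ l, (1 - x l) = ∑' k : ℕ, (-1 : ℝ) ^ k *
      ∑ s ∈ (Finset.univ : Finset (Fin N)).powersetCard k, ∏ l ∈ s, x l := by
  rw [tsum_eq_sum (s := Finset.range (N + 1))]
  · simp_rw [sub_eq_add_neg]
    rw [Finset.prod_one_add, Finset.sum_powerset, Finset.card_fin]
    refine Finset.sum_congr rfl fun k _ => ?_
    rw [Finset.mul_sum]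
    refine Finset.sum_congr rfl fun s hs => ?_
    rw [Finset.prod_neg, (Finset.mem_powersetCard.1 hs).2]
  · intro k hk
    rw [Finset.mem_range, not_lt] at hk
    rw [Finset.powersetCard_eq_empty.2 (by rw [Finset.card_fin]; exact hk), Finset.sum_empty,
      mul_zero]

/-! ### The hole probability as an infinite product -/

theorem continuous_ginibreKernel : Continuous fun p : ℂ × ℂ => ginibreKernel p.1 p.2 := by
  unfold ginibreKernel
  have := Complex.continuous_conj
  fun_prop

theorem det_ginibreKernel_of_not_injective {k : ℕ} {z : Fin k → ℂ} (hz : ¬ Function.Injective z) :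
    (Matrix.of fun i j : Fin k => ginibreKernel (z i) (z j)).det = 0 := by
  simp only [Function.Injective, not_forall] at hz
  obtain ⟨i, j, hij, hne⟩ := hz
  refine Matrix.det_zero_of_row_eq hne ?_
  ext a
  simp [hij]

variable {Ω : Type*} [MeasurableSpace Ω] {P : Measure Ω} {Λ : Ω → LocFinSubset}

/-- The factorial moments of the number of points of the Ginibre process in a disk are integrals of
determinants. -/
theorem IsInfiniteGinibre.integrable_descFactorial (hΛ : IsInfiniteGinibre P Λ) {k : ℕ}
    (hk : 1 ≤ k) (r : ℝ) :
    Integrable (fun ω => ((count (Λ ω) (Metric.closedBall 0 r)).descFactorial k : ℝ)) P ∧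
    ((∫ ω, ((count (Λ ω) (Metric.closedBall 0 r)).descFactorial k : ℝ) ∂P : ℝ) : ℂ)
      = ∫ z in Set.univ.pi fun _ : Fin k => Metric.closedBall (0 : ℂ) r,
        (Matrix.of fun i j : Fin k => ginibreKernel (z i) (z j)).det := by
  obtain ⟨hmeas, φ, hφ, hdet⟩ := hΛ
  have hB : IsCompact (Metric.closedBall (0 : ℂ) r) := isCompact_closedBall _ _
  have hlint := lintegral_descFactorial_count_eq_setLIntegral_pi hmeas hφ hk hB (by
    filter_upwards [hdet k hk] with z hz hinj
    rw [det_ginibreKernel_of_not_injective hinj] at hz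
    exact_mod_cast hz)
  have hφm : Measurable fun z => ((φ k z : ℝ≥0) : ℝ) := (hφ k hk).1.coe_nnreal_real
  have hint : IntegrableOn (fun z : Fin k → ℂ => (((φ k z : ℝ≥0) : ℝ) : ℂ))
      (Set.univ.pi fun _ : Fin k => Metric.closedBall (0 : ℂ) r) := by
    have hc : Continuous fun z : Fin k → ℂ =>
        (Matrix.of fun i j : Fin k => ginibreKernel (z i) (z j)).det := by
      refine Continuous.matrix_det (continuous_matrix fun i j => ?_)
      exact continuous_ginibreKernel.comp (by fun_prop : Continuous fun z : Fin k → ℂ => (z i, z j))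
    have h1 := hc.continuousOn.integrableOn_compact (μ := volume)
      (isCompact_univ_pi fun _ : Fin k => hB)
    exact h1.congr (ae_restrict_of_ae ((hdet k hk).mono fun z hz => hz.symm))
  have hintR : IntegrableOn (fun z : Fin k → ℂ => ((φ k z : ℝ≥0) : ℝ))
      (Set.univ.pi fun _ : Fin k => Metric.closedBall (0 : ℂ) r) := by
    exact hint.re
  have hcount : Measurable fun ω =>
      ((count (Λ ω) (Metric.closedBall 0 r)).descFactorial k : ℝ) :=
    (measurable_from_top (f := fun n : ℕ => (n.descFactorial k : ℝ))).comp
      ((measurable_count_of_isCompact hB).comp hmeas)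
  have hlint' : ∫⁻ ω, ENNReal.ofReal
        ((count (Λ ω) (Metric.closedBall 0 r)).descFactorial k : ℝ) ∂P
      = ∫⁻ z in Set.univ.pi fun _ : Fin k => Metric.closedBall (0 : ℂ) r,
        ENNReal.ofReal ((φ k z : ℝ≥0) : ℝ) := by
    simpa only [ENNReal.ofReal_natCast, ENNReal.ofReal_coe_nnreal] using hlint
  constructor
  · refine (lintegral_ofReal_ne_top_iff_integrable hcount.aestronglyMeasurable
      (ae_of_all _ fun ω => Nat.cast_nonneg _)).1 ?_
    rw [hlint']
    exact (lintegral_ofReal_ne_top_iff_integrable hφm.aestronglyMeasurable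
      (ae_of_all _ fun z => NNReal.coe_nonneg _)).2 hintR
  · rw [integral_eq_lintegral_of_nonneg_ae (ae_of_all _ fun ω => Nat.cast_nonneg _)
      hcount.aestronglyMeasurable, hlint', ← integral_eq_lintegral_of_nonneg_ae
      (ae_of_all _ fun z => NNReal.coe_nonneg _) hφm.aestronglyMeasurable,
      ← integral_complex_ofReal]
    exact integral_congr_ae (ae_restrict_of_ae (hdet k hk))

/-- The factorial moments divided by k!. The case k = 0 is separate because correlation functions
start at k = 1. -/
theorem IsInfiniteGinibre.integrable_choose [IsProbabilityMeasure P] (hΛ : IsInfiniteGinibre P Λ)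
    (k : ℕ) {r : ℝ} (hr : 0 ≤ r) :
    Integrable (fun ω => ((count (Λ ω) (Metric.closedBall 0 r)).choose k : ℝ)) P ∧
    Tendsto (fun N : ℕ => ∑ s ∈ (Finset.univ : Finset (Fin N)).powersetCard k,
        ∏ l ∈ s, (1 - poissonCDF l (r ^ 2))) atTop
      (𝓝 (∫ ω, ((count (Λ ω) (Metric.closedBall 0 r)).choose k : ℝ) ∂P)) := by
  rcases Nat.eq_zero_or_pos k with rfl | hk
  · simp
  obtain ⟨h1, h2⟩ := hΛ.integrable_descFactorial hk r
  have hchoose : ∀ n : ℕ, (n.choose k : ℝ) = (k.factorial : ℝ)⁻¹ * (n.descFactorial k : ℝ) := by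
    intro n
    rw [Nat.descFactorial_eq_factorial_mul_choose]
    push_cast
    field_simp
  simp_rw [hchoose]
  refine ⟨h1.const_mul _, ?_⟩
  have h3 := tendsto_sum_powersetCard_setIntegral_det k hr
  rw [← h2] at h3
  have h4 := ((Complex.continuous_re.tendsto _).comp h3).const_mul (k.factorial : ℝ)⁻¹
  rw [integral_const_mul]
  refine h4.congr fun N => ?_
  simp only [Function.comp, Complex.ofReal_re]
  rw [inv_mul_cancel_left₀ (by positivity)]

/-- The hole probability is the Fredholm determinant of the kernel on the disk. -/
theorem IsInfiniteGinibre.tendsto_prod_poissonCDF [IsProbabilityMeasure P]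
    (hΛ : IsInfiniteGinibre P Λ) {r : ℝ} (hr : 0 ≤ r) :
    Tendsto (fun N : ℕ => ∏ l ∈ Finset.range N, poissonCDF l (r ^ 2)) atTop
      (𝓝 (holeProbability P Λ r)) := by
  have hs : 0 ≤ r ^ 2 := sq_nonneg r
  set n : Ω → ℕ := fun ω => count (Λ ω) (Metric.closedBall 0 r)
  have hnm : Measurable n := (measurable_count_of_isCompact (isCompact_closedBall _ _)).comp hΛ.1
  set E : ℕ → ℕ → ℝ := fun N k => ∑ s ∈ (Finset.univ : Finset (Fin N)).powersetCard k,
        ∏ l ∈ s, (1 - poissonCDF l (r ^ 2))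
  have hγ : ∀ l, 0 ≤ 1 - poissonCDF l (r ^ 2) := fun l => sub_nonneg.2 (poissonCDF_le_one l hs)
  have hE0 : ∀ N k, 0 ≤ E N k := fun N k =>
    Finset.sum_nonneg fun s _ => Finset.prod_nonneg fun l _ => hγ l
  -- Summable in k and uniform in N: this bound justifies both the exchange of sum and expectation
  -- and the limit in N.
  have hbound : ∀ N k, E N k ≤ Real.exp (r ^ 2) ^ k / (k.factorial : ℝ) := by
    intro N k
    rw [le_div_iff₀ (by positivity), mul_comm]
    refine (factorial_mul_sum_powersetCard_le k fun l : Fin N => hγ l).trans ?_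
    rw [Fin.sum_univ_eq_sum_range (fun l => 1 - poissonCDF l (r ^ 2)) N]
    exact pow_le_pow_left₀ (Finset.sum_nonneg fun l _ => hγ l) (sum_one_sub_poissonCDF_le N hs) k
  have hsummable : Summable fun k : ℕ => Real.exp (r ^ 2) ^ k / (k.factorial : ℝ) :=
    Real.summable_pow_div_factorial _
  have hint := fun k => (hΛ.integrable_choose k hr).1
  have hlim := fun k => (hΛ.integrable_choose k hr).2
  have hM : ∀ k, ∫ ω, ((n ω).choose k : ℝ) ∂P ≤ Real.exp (r ^ 2) ^ k / (k.factorial : ℝ) :=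
    fun k => le_of_tendsto' (hlim k) fun N => hbound N k
  -- Inclusion-exclusion: the alternating sum of the binomial coefficients of n is the indicator of
  -- n = 0.
  have hhole : ∑' k : ℕ, (-1 : ℝ) ^ k * ∫ ω, ((n ω).choose k : ℝ) ∂P = holeProbability P Λ r := by
    have h := hasSum_integral_of_summable_integral_norm (μ := P)
      (F := fun (k : ℕ) ω => (-1 : ℝ) ^ k * ((n ω).choose k : ℝ))
      (fun k => (hint k).const_mul _) (by
        refine Summable.of_nonneg_of_le (fun k => integral_nonneg fun ω => norm_nonneg _)
          (fun k => ?_) hsummable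
        simpa using hM k)
    have hpt : ∀ ω, ∑' k : ℕ, (-1 : ℝ) ^ k * ((n ω).choose k : ℝ)
        = Set.indicator {ω | n ω = 0} 1 ω := by
      intro ω
      rw [tsum_eq_sum (s := Finset.range (n ω + 1))]
      · have := congrArg (Int.cast : ℤ → ℝ) (Int.alternating_sum_range_choose (n := n ω))
        push_cast at this
        rw [this]
        simp [Set.indicator]
      · intro k hk
        rw [Finset.mem_range, not_lt] at hk
        rw [Nat.choose_eq_zero_of_lt hk]
        simp
    simp_rw [hpt, integral_const_mul] at h
    rw [h.tsum_eq]
    exact integral_indicator_one (hnm (measurableSet_singleton 0))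
  rw [← hhole]
  have hT := tendsto_tsum_of_dominated_convergence (𝓕 := atTop)
    (f := fun N k => (-1 : ℝ) ^ k * E N k)
    (g := fun k => (-1 : ℝ) ^ k * ∫ ω, ((n ω).choose k : ℝ) ∂P) hsummable
    (fun k => (hlim k).const_mul _) (Eventually.of_forall fun N k => by
      simpa [abs_of_nonneg (hE0 N k)] using hbound N k)
  refine hT.congr fun N => ?_
  rw [← prod_one_sub_eq_tsum (fun l : Fin N => 1 - poissonCDF l (r ^ 2)),
    ← Fin.prod_univ_eq_prod_range (fun l => poissonCDF l (r ^ 2)) N]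
  simp

/-! ### Asymptotics of sums of log factorials -/

theorem mul_log_sub_self_le_log_factorial (n : ℕ) :
    n * Real.log n - n ≤ Real.log n.factorial := by
  rcases eq_or_ne n 0 with rfl | hn
  · simp
  have h := Stirling.le_log_factorial_stirling hn
  have h1 : 0 ≤ Real.log n := Real.log_natCast_nonneg n
  have h2 : 0 ≤ Real.log (2 * Real.pi) := Real.log_nonneg (by linarith [Real.pi_gt_three])
  linarith

theorem log_factorial_le_mul_log_sub_self (n : ℕ) :
    Real.log n.factorial ≤ n * Real.log n - n + Real.log n + 1 := by
  induction n with
  | zero => simp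
  | succ n ih =>
    rcases eq_or_ne n 0 with rfl | hn
    · simp
    have hn' : (0 : ℝ) < n := by positivity
    have h := Real.one_sub_inv_le_log_of_pos (x := ((n : ℝ) + 1) / n) (by positivity)
    rw [Real.log_div (by positivity) hn'.ne', inv_div] at h
    have h' : 1 ≤ ((n : ℝ) + 1) * (Real.log (n + 1) - Real.log n) := by
      calc (1 : ℝ) = (n + 1) * (1 - n / (n + 1)) := by field_simp; ring
        _ ≤ _ := by gcongr
    rw [Nat.factorial_succ, Nat.cast_mul, Real.log_mul (by positivity) (by positivity)]
    push_cast
    nlinarith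

theorem mul_log_sub_self_mono {x y : ℝ} (hx : 1 ≤ x) (hxy : x ≤ y) :
    x * Real.log x - x ≤ y * Real.log y - y := by
  have hx0 : 0 < x := by linarith
  have hy0 : 0 < y := by linarith
  have h := Real.one_sub_inv_le_log_of_pos (x := y / x) (by positivity)
  rw [Real.log_div hy0.ne' hx0.ne', inv_div] at h
  have h' : y - x ≤ y * (Real.log y - Real.log x) := by
    calc y - x = y * (1 - x / y) := by field_simp
      _ ≤ _ := by gcongr
  nlinarith [Real.log_nonneg hx]

/-- The antiderivative of `x log x - x`, which is asymptotic to `∑ l < x, log l!`. -/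
noncomputable def logBarnes (x : ℝ) : ℝ := x ^ 2 / 2 * Real.log x - 3 * x ^ 2 / 4

theorem exists_logBarnes_succ_sub {n : ℕ} (hn : n ≠ 0) : ∃ c ∈ Set.Ioo (n : ℝ) (n + 1),
    logBarnes (n + 1) - logBarnes n = c * Real.log c - c := by
  have hn' : (0 : ℝ) < n := by positivity
  have hd : ∀ x : ℝ, 0 < x → HasDerivAt logBarnes (x * Real.log x - x) x := by
    intro x hx
    have h := (((hasDerivAt_pow 2 x).div_const 2).mul (Real.hasDerivAt_log hx.ne')).sub
      (((hasDerivAt_pow 2 x).const_mul 3).div_const 4)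
    refine h.congr_deriv ?_
    simp only [Nat.cast_ofNat, Nat.add_one_sub_one, pow_one]
    field_simp
    ring
  obtain ⟨c, hc, h⟩ := exists_hasDerivAt_eq_slope logBarnes (fun x => x * Real.log x - x)
    (lt_add_one (n : ℝ)) (fun x hx => (hd x (hn'.trans_le hx.1)).continuousAt.continuousWithinAt)
    (fun x hx => hd x (hn'.trans hx.1))
  refine ⟨c, hc, ?_⟩
  rw [h, add_sub_cancel_left, div_one]

/-- By the mean value theorem each increment of `logBarnes` is c log c - c with n < c < n + 1, which
Stirling-type bounds place within O(log n) + O(1) of log n!; the errors add up. -/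
theorem abs_sum_log_factorial_sub_le (M : ℕ) :
    |∑ l ∈ Finset.range M, Real.log l.factorial - logBarnes M| ≤ M * Real.log M + M := by
  have key : ∀ n : ℕ, logBarnes (n + 1) - logBarnes n - Real.log (n + 1) ≤ Real.log n.factorial ∧
      Real.log n.factorial ≤ logBarnes (n + 1) - logBarnes n + Real.log n + 1 := by
    intro n
    rcases eq_or_ne n 0 with rfl | hn
    · norm_num [logBarnes]
    obtain ⟨c, hc, h⟩ := exists_logBarnes_succ_sub hn
    have hn1 : (1 : ℝ) ≤ n := by exact_mod_cast Nat.one_le_iff_ne_zero.2 hn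
    have h1 := mul_log_sub_self_mono hn1 hc.1.le
    have h2 := mul_log_sub_self_mono (hn1.trans hc.1.le) hc.2.le
    have h3 := mul_log_sub_self_le_log_factorial (n + 1)
    have h4 := log_factorial_le_mul_log_sub_self n
    rw [Nat.factorial_succ, Nat.cast_mul, Real.log_mul (by positivity) (by positivity)] at h3
    push_cast at h3
    constructor <;> linarith
  have hlog : ∀ n : ℕ, (n : ℝ) * Real.log n ≤ n * Real.log (n + 1) := by
    intro n
    rcases eq_or_ne n 0 with rfl | hn
    · simp
    gcongr
    linarith
  rw [abs_le]
  induction M with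
  | zero => simp [logBarnes]
  | succ n ih =>
    have h1 := hlog n
    have hl : Real.log n ≤ Real.log (n + 1) := by
      rcases eq_or_ne n 0 with rfl | hn
      · simp
      gcongr
      linarith
    obtain ⟨h2, h3⟩ := key n
    obtain ⟨h4, h5⟩ := ih
    rw [Finset.sum_range_succ]
    push_cast
    constructor <;> nlinarith

theorem tendsto_log_div_self : Tendsto (fun x : ℝ => Real.log x / x) atTop (𝓝 0) :=
  Real.isLittleO_log_id_atTop.tendsto_div_nhds_zero

theorem tendsto_sum_log_factorial : Tendsto (fun M : ℕ =>
    (∑ l ∈ Finset.range M, Real.log l.factorial) / (M : ℝ) ^ 2 - Real.log M / 2) atTop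
      (𝓝 (-(3 / 4))) := by
  have h0 : Tendsto (fun M : ℕ => Real.log M / M + 1 / (M : ℝ)) atTop (𝓝 0) := by
    simpa using (tendsto_log_div_self.comp tendsto_natCast_atTop_atTop).add
      tendsto_one_div_atTop_nhds_zero_nat
  rw [tendsto_iff_norm_sub_tendsto_zero]
  refine squeeze_zero' (Eventually.of_forall fun M => norm_nonneg _) ?_ h0
  filter_upwards [eventually_gt_atTop 0] with M hM
  have hM' : (0 : ℝ) < M := by exact_mod_cast hM
  have h1 : (∑ l ∈ Finset.range M, Real.log l.factorial) / (M : ℝ) ^ 2 - Real.log M / 2 - -(3 / 4)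
      = (∑ l ∈ Finset.range M, Real.log l.factorial - logBarnes M) / (M : ℝ) ^ 2 := by
    rw [logBarnes]
    field_simp
    ring
  rw [h1, Real.norm_eq_abs, abs_div, abs_of_pos (a := (M : ℝ) ^ 2) (by positivity)]
  calc _ ≤ (M * Real.log M + M) / (M : ℝ) ^ 2 := by
        gcongr
        exact abs_sum_log_factorial_sub_le M
    _ = _ := by field_simp

/-- The logarithm of the product of the Poisson weights `e⁻ˢ sˡ / l!` over `l < ⌊s⌋`. -/
noncomputable def logPoissonProd (s : ℝ) : ℝ :=
  ∑ l ∈ Finset.range ⌊s⌋₊, (-s + l * Real.log s - Real.log l.factorial)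

theorem tendsto_logPoissonProd :
    Tendsto (fun s => logPoissonProd s / s ^ 2) atTop (𝓝 (-(1 / 4))) := by
  have hM : Tendsto (fun s : ℝ => (⌊s⌋₊ : ℝ) / s) atTop (𝓝 1) := tendsto_nat_floor_div_atTop
  have hG := tendsto_sum_log_factorial.comp (tendsto_nat_floor_atTop (α := ℝ))
  have hlog : Tendsto (fun s : ℝ => Real.log ((⌊s⌋₊ : ℝ) / s)) atTop (𝓝 0) := by
    have := (Real.continuousAt_log one_ne_zero).tendsto.comp hM
    rwa [Real.log_one] at this
  have h := (((hM.neg.sub ((hM.pow 2).mul hG)).sub (((hM.pow 2).mul hlog).div_const 2))).sub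
    ((hM.mul tendsto_log_div_self).div_const 2)
  -- With M = ⌊s⌋, the -1 comes from the factors e⁻ˢ and the 3/4 from the factorials; the s² log s
  -- terms cancel up to M² log(M/s)/2 and M log s / 2, both o(s²).
  have hval : (-1 - 1 ^ 2 * -(3 / 4) - 1 ^ 2 * 0 / 2 - 1 * 0 / 2 : ℝ) = -(1 / 4) := by norm_num
  rw [hval] at h
  refine h.congr' ?_
  filter_upwards [eventually_ge_atTop 1] with s hs
  have hs0 : 0 < s := by linarith
  have hM0 : (0 : ℝ) < ⌊s⌋₊ := by exact_mod_cast Nat.floor_pos.2 hs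
  simp only [Function.comp]
  rw [logPoissonProd, Finset.sum_sub_distrib, Finset.sum_add_distrib, ← Finset.sum_mul,
    Real.log_div hM0.ne' hs0.ne', Finset.sum_const, Finset.card_range]
  have hgauss : ∑ l ∈ Finset.range ⌊s⌋₊, (l : ℝ) = ⌊s⌋₊ * (⌊s⌋₊ - 1) / 2 := by
    have : ∀ n : ℕ, ∑ l ∈ Finset.range n, (l : ℝ) = n * (n - 1) / 2 := by
      intro n
      induction n with
      | zero => simp
      | succ n ih => rw [Finset.sum_range_succ, ih]; push_cast; ring
    exact this _
  rw [hgauss, nsmul_eq_mul]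
  field_simp
  ring

/-! ### Two-sided bounds for the infinite product -/

theorem weight_le_poissonCDF (l : ℕ) {s : ℝ} (hs : 0 ≤ s) :
    Real.exp (-s) * (s ^ l / (l.factorial : ℝ)) ≤ poissonCDF l s := by
  rw [poissonCDF]
  gcongr
  exact Finset.single_le_sum (f := fun j => s ^ j / (j.factorial : ℝ))
    (fun j _ => by positivity) (Finset.self_mem_range_succ l)

theorem poissonCDF_pos (l : ℕ) {s : ℝ} (hs : 0 < s) : 0 < poissonCDF l s :=
  lt_of_lt_of_le (by positivity) (weight_le_poissonCDF l hs.le)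

/-- The weights sʲ/j! increase for j ≤ s, so the last of the l + 1 terms is the largest. -/
theorem poissonCDF_le_mul_weight {l : ℕ} {s : ℝ} (hl : l ≤ s) :
    poissonCDF l s ≤ (l + 1) * (Real.exp (-s) * (s ^ l / (l.factorial : ℝ))) := by
  have hs : 0 ≤ s := (Nat.cast_nonneg l).trans hl
  have h : ∀ d j : ℕ, j + d = l →
      s ^ j / (j.factorial : ℝ) ≤ s ^ l / (l.factorial : ℝ) := by
    intro d
    induction d with
    | zero => rintro j rfl; rfl
    | succ d ih =>
      intro j hj
      refine le_trans ?_ (ih (j + 1) (by omega))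
      have hjs : ((j : ℝ) + 1) ≤ s := by
        refine le_trans ?_ hl
        exact_mod_cast (by omega : j + 1 ≤ l)
      rw [Nat.factorial_succ, pow_succ, Nat.cast_mul, mul_comm ((j + 1 : ℕ) : ℝ), mul_div_mul_comm]
      push_cast
      exact le_mul_of_one_le_right (by positivity) ((one_le_div (by positivity)).2 hjs)
  rw [poissonCDF, mul_left_comm]
  gcongr
  calc _ ≤ ∑ j ∈ Finset.range (l + 1), s ^ l / (l.factorial : ℝ) := by
        refine Finset.sum_le_sum fun j hj => h (l - j) j ?_
        have := Finset.mem_range.1 hj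
        omega
    _ = _ := by simp

theorem log_weight (l : ℕ) {s : ℝ} (hs : 0 < s) :
    Real.log (Real.exp (-s) * (s ^ l / (l.factorial : ℝ)))
      = -s + l * Real.log s - Real.log l.factorial := by
  rw [Real.log_mul (by positivity) (by positivity), Real.log_exp,
    Real.log_div (by positivity) (by positivity), Real.log_pow]
  ring

theorem poissonCDF_mono_left {s : ℝ} (hs : 0 ≤ s) : Monotone fun l => poissonCDF l s := by
  refine monotone_nat_of_le_succ fun l => ?_
  rw [poissonCDF_succ]
  exact le_add_of_nonneg_right (by positivity)

theorem sum_log_poissonCDF_le {s : ℝ} (hs : 1 ≤ s) :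
    ∑ l ∈ Finset.range ⌊s⌋₊, Real.log (poissonCDF l s) ≤ logPoissonProd s + s * Real.log s := by
  have hs0 : 0 < s := by linarith
  calc _ ≤ ∑ l ∈ Finset.range ⌊s⌋₊,
        ((-s + l * Real.log s - Real.log l.factorial) + Real.log s) := by
        refine Finset.sum_le_sum fun l hl => ?_
        have hl1 : ((l + 1 : ℕ) : ℝ) ≤ s :=
          (Nat.cast_le.2 (Finset.mem_range.1 hl)).trans (Nat.floor_le hs0.le)
        push_cast at hl1
        have h := Real.log_le_log (poissonCDF_pos l hs0)
          (poissonCDF_le_mul_weight (l := l) (s := s) (by linarith))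
        rw [Real.log_mul (by positivity) (by positivity), log_weight l hs0] at h
        have h2 := Real.log_le_log (by positivity) hl1
        linarith
    _ = logPoissonProd s + ⌊s⌋₊ * Real.log s := by
        rw [Finset.sum_add_distrib, logPoissonProd]
        simp
    _ ≤ _ := by
        gcongr
        · exact Real.log_nonneg hs
        · exact Nat.floor_le hs0.le

/-- By monotonicity in l, only the weight at the mode ⌊s⌋ has to be bounded below, and the upper
bound on the factorial does this. -/
theorem neg_two_sub_log_le_log_poissonCDF {l : ℕ} {s : ℝ} (hs : 1 ≤ s) (hl : ⌊s⌋₊ ≤ l) :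
    -2 - Real.log s ≤ Real.log (poissonCDF l s) := by
  have hs0 : 0 < s := by linarith
  have hM0 : (0 : ℝ) < ⌊s⌋₊ := by exact_mod_cast Nat.floor_pos.2 hs
  have hMs : (⌊s⌋₊ : ℝ) ≤ s := Nat.floor_le hs0.le
  have hsM : s < ⌊s⌋₊ + 1 := Nat.lt_floor_add_one s
  have h1 := Real.log_le_log (by positivity)
    ((weight_le_poissonCDF ⌊s⌋₊ hs0.le).trans (poissonCDF_mono_left hs0.le hl))
  rw [log_weight _ hs0] at h1
  have h2 := log_factorial_le_mul_log_sub_self ⌊s⌋₊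
  have h3 := Real.log_le_log hM0 hMs
  have h4 := mul_le_mul_of_nonneg_left h3 hM0.le
  linarith

theorem le_sum_log_poissonCDF {s : ℝ} (hs : 1 ≤ s) {N : ℕ} (hMN : ⌊s⌋₊ ≤ N) (hN : N ≤ 4 * s) :
    logPoissonProd s - 4 * s * (2 + Real.log s)
      ≤ ∑ l ∈ Finset.range N, Real.log (poissonCDF l s) := by
  have hs0 : 0 < s := by linarith
  have hlog := Real.log_nonneg hs
  rw [← Finset.sum_range_add_sum_Ico _ hMN, sub_eq_add_neg]
  refine add_le_add (Finset.sum_le_sum fun l _ => ?_) ?_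
  · rw [← log_weight l hs0]
    exact Real.log_le_log (by positivity) (weight_le_poissonCDF l hs0.le)
  · calc -(4 * s * (2 + Real.log s)) ≤ -(((N - ⌊s⌋₊ : ℕ) : ℝ) * (2 + Real.log s)) := by
          gcongr
          exact (Nat.cast_le.2 (Nat.sub_le _ _)).trans hN
      _ = ∑ l ∈ Finset.Ico ⌊s⌋₊ N, (-2 - Real.log s) := by
          rw [Finset.sum_const, Nat.card_Ico, nsmul_eq_mul]
          ring
      _ ≤ _ := Finset.sum_le_sum fun l hl =>
          neg_two_sub_log_le_log_poissonCDF hs (Finset.mem_Ico.1 hl).1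

theorem one_sub_sum_le_prod {ι : Type*} (t : Finset ι) {q : ι → ℝ} (h0 : ∀ i, 0 ≤ q i)
    (h1 : ∀ i, q i ≤ 1) : 1 - ∑ i ∈ t, (1 - q i) ≤ ∏ i ∈ t, q i := by
  classical
  induction t using Finset.induction_on with
  | empty => simp
  | insert a t ha ih =>
    rw [Finset.sum_insert ha, Finset.prod_insert ha]
    have hp : ∏ i ∈ t, q i ≤ 1 := Finset.prod_le_one (fun i _ => h0 i) fun i _ => h1 i
    nlinarith [h0 a, h1 a]

theorem half_le_prod_Ico_poissonCDF {s : ℝ} (hs : 0 ≤ s) {N : ℕ} (hN : 2 * s + 1 ≤ N) (N' : ℕ) :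
    1 / 2 ≤ ∏ l ∈ Finset.Ico N N', poissonCDF l s := by
  have h1 : ∑ l ∈ Finset.Ico N N', (1 - poissonCDF l s) ≤ (1 / 2) ^ N * Real.exp s := by
    rw [Finset.sum_Ico_eq_sum_range]
    calc _ ≤ ∑ i ∈ Finset.range (N' - N), (1 / 2 : ℝ) ^ (N + i + 1) * Real.exp s :=
          Finset.sum_le_sum fun l _ => one_sub_poissonCDF_le _ hs
      _ = (1 / 2) ^ N * ((∑ i ∈ Finset.range (N' - N), (1 / 2 : ℝ) ^ i) * (1 / 2)) *
          Real.exp s := by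
          simp only [pow_succ, pow_add, Finset.sum_mul, Finset.mul_sum]
          refine Finset.sum_congr rfl fun i _ => ?_
          ring
      _ ≤ (1 / 2) ^ N * (2 * (1 / 2)) * Real.exp s := by
          gcongr
          exact sum_geometric_two_le _
      _ = _ := by ring
  -- N ≥ 2s + 1 is enough because 2 log 2 > 1.
  have h2 : (1 / 2 : ℝ) ^ N * Real.exp s ≤ 1 / 2 := by
    have hl := Real.log_two_gt_d9
    rw [← Real.rpow_natCast, Real.rpow_def_of_pos (by norm_num), ← Real.exp_add,
      ← Real.le_log_iff_exp_le (by norm_num), one_div, Real.log_inv]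
    nlinarith
  have h3 := one_sub_sum_le_prod (Finset.Ico N N') (q := fun l => poissonCDF l s)
    (fun l => by rw [poissonCDF]; positivity) (fun l => poissonCDF_le_one l hs)
  linarith

theorem log_bounds_of_tendsto_prod {s H : ℝ} (hs : 3 ≤ s)
    (hH : Tendsto (fun N : ℕ => ∏ l ∈ Finset.range N, poissonCDF l s) atTop (𝓝 H)) :
    logPoissonProd s - 4 * s * (2 + Real.log s) - Real.log 2 ≤ Real.log H ∧
      Real.log H ≤ logPoissonProd s + s * Real.log s := by
  have hs0 : 0 < s := by linarith
  have hpos : ∀ N, 0 < ∏ l ∈ Finset.range N, poissonCDF l s := fun N =>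
    Finset.prod_pos fun l _ => poissonCDF_pos l hs0
  have hanti : Antitone fun N : ℕ => ∏ l ∈ Finset.range N, poissonCDF l s := by
    refine antitone_nat_of_succ_le fun N => ?_
    rw [Finset.prod_range_succ]
    exact mul_le_of_le_one_right (hpos N).le (poissonCDF_le_one N hs0.le)
  have hlogprod : ∀ N, Real.log (∏ l ∈ Finset.range N, poissonCDF l s)
      = ∑ l ∈ Finset.range N, Real.log (poissonCDF l s) := fun N =>
    Real.log_prod fun l _ => (poissonCDF_pos l hs0).ne'
  -- Large enough for the factors beyond N to multiply to at least 1/2, yet still O(s), so that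
  -- those between ⌊s⌋ and N cost only O(s log s).
  set N := ⌈2 * s⌉₊ + 1 with hNdef
  have hN1 : 2 * s + 1 ≤ N := by
    rw [hNdef]
    push_cast
    linarith [Nat.le_ceil (2 * s)]
  have hN2 : (N : ℝ) ≤ 4 * s := by
    rw [hNdef]
    push_cast
    linarith [Nat.ceil_lt_add_one (by linarith : 0 ≤ 2 * s)]
  have hMN : ⌊s⌋₊ ≤ N := by
    have := Nat.floor_le hs0.le
    exact_mod_cast (by linarith : (⌊s⌋₊ : ℝ) ≤ N)
  have hlow : (∏ l ∈ Finset.range N, poissonCDF l s) * (1 / 2) ≤ H := by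
    refine ge_of_tendsto hH ?_
    filter_upwards [eventually_ge_atTop N] with N' hN'
    rw [← Finset.prod_range_mul_prod_Ico _ hN']
    exact mul_le_mul_of_nonneg_left (half_le_prod_Ico_poissonCDF hs0.le hN1 N') (hpos N).le
  have hH0 : 0 < H := lt_of_lt_of_le (mul_pos (hpos N) one_half_pos) hlow
  constructor
  · have h := Real.log_le_log (mul_pos (hpos N) one_half_pos) hlow
    rw [Real.log_mul (hpos N).ne' (by norm_num), hlogprod, one_div, Real.log_inv] at h
    linarith [le_sum_log_poissonCDF (by linarith : 1 ≤ s) hMN hN2]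
  · have h := Real.log_le_log hH0 (hanti.le_of_tendsto hH ⌊s⌋₊)
    rw [hlogprod] at h
    exact h.trans (sum_log_poissonCDF_le (by linarith))

theorem tendsto_log_div_sq_of_tendsto_prod {H : ℝ → ℝ} (hH : ∀ s, 0 ≤ s →
    Tendsto (fun N : ℕ => ∏ l ∈ Finset.range N, poissonCDF l s) atTop (𝓝 (H s))) :
    Tendsto (fun s => Real.log (H s) / s ^ 2) atTop (𝓝 (-(1 / 4))) := by
  have hinv : Tendsto (fun s : ℝ => s⁻¹) atTop (𝓝 0) := tendsto_inv_atTop_zero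
  have hlow : Tendsto (fun s => logPoissonProd s / s ^ 2 - 4 * (2 * s⁻¹ + Real.log s / s)
      - Real.log 2 * (s⁻¹) ^ 2) atTop (𝓝 (-(1 / 4))) := by
    have := (tendsto_logPoissonProd.sub
      (((hinv.const_mul 2).add tendsto_log_div_self).const_mul 4)).sub
      ((hinv.pow 2).const_mul (Real.log 2))
    simpa using this
  have hup : Tendsto (fun s => logPoissonProd s / s ^ 2 + Real.log s / s) atTop
      (𝓝 (-(1 / 4))) := by
    simpa using tendsto_logPoissonProd.add tendsto_log_div_self
  refine tendsto_of_tendsto_of_tendsto_of_le_of_le' hlow hup ?_ ?_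
  · filter_upwards [eventually_ge_atTop 3] with s hs
    have hs0 : 0 < s := by linarith
    rw [le_div_iff₀ (by positivity)]
    refine le_trans (le_of_eq ?_) (log_bounds_of_tendsto_prod hs (hH s hs0.le)).1
    field_simp
  · filter_upwards [eventually_ge_atTop 3] with s hs
    have hs0 : 0 < s := by linarith
    rw [div_le_iff₀ (by positivity)]
    refine (log_bounds_of_tendsto_prod hs (hH s hs0.le)).2.trans (le_of_eq ?_)
    field_simp

end PointProcess

theorem mainTheorem12 {Ω : Type*} [MeasurableSpace Ω] (P : Measure Ω) [IsProbabilityMeasure P]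
    (Λ : Ω → PointProcess.LocFinSubset) (hΛ : PointProcess.IsInfiniteGinibre P Λ) :
    Tendsto (fun r : ℝ => Real.log (PointProcess.holeProbability P Λ r) / r ^ 4)
      atTop (𝓝 (-(1 / 4) : ℝ)) := by
  -- The product depends on the radius through s = r², which turns s² into r⁴.
  have h := PointProcess.tendsto_log_div_sq_of_tendsto_prod
    (H := fun s => PointProcess.holeProbability P Λ (Real.sqrt s)) fun s hs => by
      have := hΛ.tendsto_prod_poissonCDF (Real.sqrt_nonneg s)
      rwa [Real.sq_sqrt hs] at this
  refine (h.comp (tendsto_pow_atTop two_ne_zero)).congr' ?_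
  filter_upwards [eventually_ge_atTop 0] with r hr
  simp only [Function.comp, Real.sqrt_sq hr, ← pow_mul]
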